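/- An idempotent functor is a pair $(\phi,\epsilon)$ consisting of a functor $\phi$ from the category of groups to itself and a natural transformation $\epsilon_G:\phi(G)\to G$ such that, for every group $G$, both homomorphisms $\epsilon_{\phi(G)},\ \phi(\epsilon_G):\phi(\phi(G))\to\phi(G)$ are isomorphisms. For a group $G$ and an integer $n\ge 1$, let $\mathrm{Idem}^n(G)$ be the collection of isomorphism classes of the groups $\phi_1\cdots\phi_n(G)$, where $(\phi_1,\epsilon_1),\dots,(\phi_n,\epsilon_n)$ are arbitrary idempotent functors, and let $\mathrm{Idem}^\infty(G)=\bigcup_{n\ge1}\mathrm{Idem}^n(G)$. A cellular cover of a group $Y$ is a homomorphism $c:X\to Y$ such that $h\mapsto c\circ h$ is a bijection $\mathrm{Hom}(X,X)\to\mathrm{Hom}(X,Y)$. A 2-iterated cellular cover of $G$ is a homomorphism $X\to G$ that is a composition $c_1c_2$ of cellular covers $c_2:X\to X_1$ and $c_1:X_1\to G$. Homomorphisms $a:X\to G$ and $b:Y\to G$ are equivalent if $a=b\circ h$ for some isomorphism $h:X\to Y$. Theorem. Let $G$ be a finite group. Then $\mathrm{Idem}^\infty(G)$ is a finite set. If $G$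 is moreover simple, then $\mathrm{Idem}^\infty(G)=\mathrm{Idem}^2(G)$, and the function that sends the equivalence class of a 2-iterated cellular cover $f:X\to G$ to the isomorphism class of $X$ is a bijection from the set of equivalence classes of 2-iterated cellular covers of $G$ onto $\mathrm{Idem}^\infty(G)$. -/

import Mathlib

open CategoryTheory

universe u

/-- An idempotent functor: an endofunctor `φ` of the category of groups with an augmentation
`ε_G : φ(G) ⟶ G`, natural in `G`, such that both `ε_{φ(G)}` and `φ(ε_G)`, as homomorphisms
`φ(φ(G)) ⟶ φ(G)`, are isomorphisms for every group `G`. -/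
structure IdempotentFunctor where
  /-- The underlying functor. -/
  functor : GrpCat.{u} ⥤ GrpCat.{u}
  /-- The augmentation. -/
  aug : functor ⟶ 𝟭 GrpCat.{u}
  isIso_aug_obj : ∀ G : GrpCat.{u}, IsIso (aug.app (functor.obj G))
  isIso_map_aug : ∀ G : GrpCat.{u}, IsIso (functor.map (aug.app G))

/-- The composite `φ₁ φ₂ ⋯ φₙ` (the last one is applied first) of a list `[φ₁, …, φₙ]` of
idempotent functors. -/
def compositeFunctor : List IdempotentFunctor.{u} → (GrpCat.{u} ⥤ GrpCat.{u})
  | [] => 𝟭 GrpCat.{u}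
  | φ :: l => compositeFunctor l ⋙ φ.functor

/-- Isomorphism classes of groups. -/
abbrev GroupClass : Type (u + 1) := Quotient (isIsomorphicSetoid GrpCat.{u})

/-- The isomorphism class of a group. -/
def groupClass (X : GrpCat.{u}) : GroupClass.{u} :=
  Quotient.mk (isIsomorphicSetoid GrpCat.{u}) X

/-- `Idem^n(G)`: the isomorphism classes of the groups `φ₁ ⋯ φₙ(G)`, with all `φᵢ` idempotent. -/
def IdemIter (n : ℕ) (G : GrpCat.{u}) : Set GroupClass.{u} :=
  {x | ∃ l : List IdempotentFunctor.{u}, l.length = n ∧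
    x = groupClass ((compositeFunctor l).obj G)}

/-- `Idem^∞(G)`: the union of the `Idem^n(G)` over all `n ≥ 1`. -/
def IdemInfty (G : GrpCat.{u}) : Set GroupClass.{u} :=
  ⋃ n ∈ Set.Ici 1, IdemIter n G

/-- A cellular cover of `G`: a homomorphism `c : A ⟶ G` such that composition with `c` is a
bijection from `Hom(A, A)` to `Hom(A, G)`. -/
def IsCellularCover {A G : GrpCat.{u}} (c : A ⟶ G) : Prop :=
  Function.Bijective (fun h : A ⟶ A => h ≫ c)

/-- `IsIteratedCellularCover n f`: the homomorphism `f` is a composition of `n ≥ 1` cellular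
covers `Xₙ ⟶ ⋯ ⟶ X₁ ⟶ G`, each one being a cellular cover of its own target. -/
inductive IsIteratedCellularCover : ℕ → ∀ {X G : GrpCat.{u}}, (X ⟶ G) → Prop
  | single {X G : GrpCat.{u}} {c : X ⟶ G} (hc : IsCellularCover c) :
      IsIteratedCellularCover 1 c
  | comp {n : ℕ} {X Y G : GrpCat.{u}} {f : X ⟶ Y} {c : Y ⟶ G}
      (hf : IsIteratedCellularCover n f) (hc : IsCellularCover c) :
      IsIteratedCellularCover (n + 1) (f ≫ c)

/-- Equivalence classes of homomorphisms into `G`, where `a : X ⟶ G` and `b : Y ⟶ G` are equivalent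
if there is an isomorphism `h : X ⟶ Y` with `b h = a`. -/
abbrev HomClass (G : GrpCat.{u}) : Type (u + 1) := Quotient (isIsomorphicSetoid (Over G))

/-- The equivalence class of a homomorphism into `G`. -/
def homClass {X G : GrpCat.{u}} (f : X ⟶ G) : HomClass G :=
  Quotient.mk (isIsomorphicSetoid (Over G)) (Over.mk f)

/-- The set of equivalence classes of `n`-iterated cellular covers of `G`. -/
def CovIter (n : ℕ) (G : GrpCat.{u}) : Set (HomClass G) :=
  {x | ∃ (X : GrpCat.{u}) (f : X ⟶ G), IsIteratedCellularCover n f ∧ x = homClass f}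

/-- The function that sends the equivalence class of `f : X ⟶ G` to the isomorphism class of `X`. -/
def sourceClass (G : GrpCat.{u}) : HomClass G → GroupClass.{u} :=
  Quotient.lift (s := isIsomorphicSetoid (Over G)) (fun f : Over G => groupClass f.left)
    (fun _ _ ⟨e⟩ => Quotient.sound (s := isIsomorphicSetoid GrpCat.{u})
      ⟨(Over.forget G).mapIso e⟩)

/-! Up to isomorphism of the source, cellular covers are the same as augmentations of idempotent
functors: a cover by X is the augmentation at G of X-cellularization, which exists for every X. So
the task is to control iterated covers of G.

Finiteness. Comparing endomorphisms of A after composition with a cover c of a finite group shows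
that ker c is central and lies in [A, A]; hence A is finite. A composite f : X → G of covers is a
crossed module (`IsCrossed.comp`), so ker f is central and Schur's theorem bounds |[X, X]| by some B
depending only on |G|. The number |X^ab| · B^|f(X)| never grows under a further cover
(`card_abelianization_mul_pow_le`): if the image in G is unchanged, the new abelianization embeds in
the old one; if the image shrinks, the lost factor B pays for the growth. This bounds |X|.

Simple G. The image of a crossed module is normal, so it is trivial or G. A surjective composite is
again a single cover; a trivial one has abelian source, and further covers of that source merge with
the last one. So two steps suffice (`IsSimpleTower.comp`). The source determines the map
(`IsSimpleTower.exists_mulEquiv`): surjective covers with isomorphic sources lift through each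
other, trivial maps agree, and the two kinds never share a source. -/

/-! ### Existence of X-cellularization. -/

section Cellularization

/-- A homomorphism `f` is an `X`-equivalence if composition with it is a bijection
`Hom(X, Y) → Hom(X, Z)`. -/
def IsHomEquiv (X : Type*) [Group X] {Y Z : Type*} [Group Y] [Group Z] (f : Y →* Z) : Prop :=
  Function.Bijective fun h : X →* Y => f.comp h

/-- Two homomorphisms from `X` to `P ⧸ M` agree as soon as they agree modulo the kernel of `e`. -/
def HomSeparating (X : Type*) [Group X] {P H : Type*} [Group P] [Group H] (e : P →* H)
    (M : Subgroup P) [M.Normal] : Prop :=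
  ∀ a b : X →* P ⧸ M, (∀ x (p q : P), a x = p → b x = q → e p = e q) → a = b

/-- The least normal subgroup `N` below the kernel of `e` such that homomorphisms from `X` to
`P ⧸ N` are determined by their composition with `P ⧸ N → H`. -/
def separatingKernel (X : Type*) [Group X] {P H : Type*} [Group P] [Group H] (e : P →* H) :
    Subgroup P :=
  sInf {M | M ≤ e.ker ∧ ∃ _ : M.Normal, HomSeparating X e M}

variable (X : Type*) [Group X] {P H : Type*} [Group P] [Group H] (e : P →* H)

instance separatingKernel_normal : (separatingKernel X e).Normal where
  conj_mem n hn g := by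
    rw [separatingKernel, Subgroup.mem_sInf] at hn ⊢
    rintro M ⟨hM, hMn, hMs⟩
    exact hMn.conj_mem n (hn M ⟨hM, hMn, hMs⟩) g

theorem separatingKernel_le_of_homSeparating {M : Subgroup P} [hn : M.Normal] (hM : M ≤ e.ker)
    (hs : HomSeparating X e M) : separatingKernel X e ≤ M :=
  sInf_le ⟨hM, hn, hs⟩

theorem homSeparating_ker : HomSeparating X e e.ker := by
  intro a b hab
  ext x
  obtain ⟨p, hp⟩ := QuotientGroup.mk_surjective (a x)
  obtain ⟨q, hq⟩ := QuotientGroup.mk_surjective (b x)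
  rw [← hp, ← hq, QuotientGroup.eq, MonoidHom.mem_ker, map_mul, map_inv,
    hab x p q hp.symm hq.symm, inv_mul_cancel]

theorem separatingKernel_le_ker : separatingKernel X e ≤ e.ker :=
  separatingKernel_le_of_homSeparating X e le_rfl (homSeparating_ker X e)

theorem homSeparating_separatingKernel : HomSeparating X e (separatingKernel X e) := by
  intro a b hab
  ext x
  obtain ⟨p, hp⟩ := QuotientGroup.mk_surjective (a x)
  obtain ⟨q, hq⟩ := QuotientGroup.mk_surjective (b x)
  rw [← hp, ← hq, QuotientGroup.eq]
  refine Subgroup.mem_sInf.2 ?_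
  rintro M ⟨hM, hMn, hMs⟩
  have hle : separatingKernel X e ≤ M := sInf_le ⟨hM, hMn, hMs⟩
  let π : P ⧸ separatingKernel X e →* P ⧸ M := QuotientGroup.map _ _ (MonoidHom.id P) hle
  have hπ : ∀ r : P, π (r : P ⧸ separatingKernel X e) = (r : P ⧸ M) := fun r => rfl
  have key : π.comp a = π.comp b := by
    refine hMs _ _ fun y r s hr hs => ?_
    obtain ⟨r', hr'⟩ := QuotientGroup.mk_surjective (a y)
    obtain ⟨s', hs'⟩ := QuotientGroup.mk_surjective (b y)
    rw [MonoidHom.comp_apply, ← hr', hπ, QuotientGroup.eq] at hr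
    rw [MonoidHom.comp_apply, ← hs', hπ, QuotientGroup.eq] at hs
    have h1 := hM hr
    have h2 := hM hs
    rw [MonoidHom.mem_ker, map_mul, map_inv, inv_mul_eq_one] at h1 h2
    rw [← h1, ← h2]
    exact hab y r' s' hr'.symm hs'.symm
  have := DFunLike.congr_fun key x
  rwa [MonoidHom.comp_apply, MonoidHom.comp_apply, ← hp, ← hq, hπ, hπ, QuotientGroup.eq] at this

/-- A lift to `Y` of a homomorphism `P ⧸ separatingKernel X e → Z` along an `X`-equivalence
`Y → Z` kills the separating kernel. -/
theorem separatingKernel_le_ker_of_isHomEquiv {Y Z : Type*} [Group Y] [Group Z] {f : Y →* Z}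
    (hf : IsHomEquiv X f) (g : P ⧸ separatingKernel X e →* Z) (k : P →* Y)
    (hk : ∀ p : P, f (k p) = g p) : separatingKernel X e ≤ k.ker := by
  have hMe : separatingKernel X e ⊓ k.ker ≤ e.ker :=
    inf_le_left.trans (separatingKernel_le_ker X e)
  -- By minimality it is enough that N ⊓ ker k separates, where N is the separating kernel. Modulo
  -- it, a homomorphism from X is detected by its projections to P ⧸ N and to Y; agreement in P ⧸ N
  -- gives agreement in Z, and then in Y because f is an X-equivalence.
  refine (separatingKernel_le_of_homSeparating X e (M := separatingKernel X e ⊓ k.ker) hMe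
    fun a b hab => ?_).trans inf_le_right
  let π : P ⧸ (separatingKernel X e ⊓ k.ker) →* P ⧸ separatingKernel X e :=
    QuotientGroup.map _ _ (MonoidHom.id P) inf_le_left
  let κ : P ⧸ (separatingKernel X e ⊓ k.ker) →* Y :=
    QuotientGroup.lift _ k fun p hp => hp.2
  have hπ : ∀ r : P, π r = (r : P ⧸ separatingKernel X e) := fun r => rfl
  have hκ : ∀ r : P, κ r = k r := fun r => rfl
  have h1 : π.comp a = π.comp b := by
    refine homSeparating_separatingKernel X e _ _ fun y r s hr hs => ?_
    obtain ⟨r', hr'⟩ := QuotientGroup.mk_surjective (a y)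
    obtain ⟨s', hs'⟩ := QuotientGroup.mk_surjective (b y)
    rw [MonoidHom.comp_apply, ← hr', hπ, QuotientGroup.eq] at hr
    rw [MonoidHom.comp_apply, ← hs', hπ, QuotientGroup.eq] at hs
    have h1 := separatingKernel_le_ker X e hr
    have h2 := separatingKernel_le_ker X e hs
    rw [MonoidHom.mem_ker, map_mul, map_inv, inv_mul_eq_one] at h1 h2
    rw [← h1, ← h2]
    exact hab y r' s' hr'.symm hs'.symm
  have hfκ : ∀ z, f (κ z) = g (π z) := by
    intro z
    obtain ⟨r, rfl⟩ := QuotientGroup.mk_surjective z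
    exact hk r
  have h2 : κ.comp a = κ.comp b := by
    refine hf.1 ?_
    ext x
    have := DFunLike.congr_fun h1 x
    simp only [MonoidHom.comp_apply] at this ⊢
    rw [hfκ, hfκ, this]
  ext x
  obtain ⟨p, hp⟩ := QuotientGroup.mk_surjective (a x)
  obtain ⟨q, hq⟩ := QuotientGroup.mk_surjective (b x)
  have h1x := DFunLike.congr_fun h1 x
  have h2x := DFunLike.congr_fun h2 x
  simp only [MonoidHom.comp_apply] at h1x h2x
  rw [← hp, ← hq] at h1x h2x ⊢
  rw [hπ, hπ, QuotientGroup.eq] at h1x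
  rw [hκ, hκ] at h2x
  rw [QuotientGroup.eq]
  exact Subgroup.mem_inf.2
    ⟨h1x, by rw [MonoidHom.mem_ker, map_mul, map_inv, h2x, inv_mul_cancel]⟩

end Cellularization

/-- The evaluation homomorphism from the free product of copies of `X` indexed by `Hom(X, H)`. -/
def evalCoprod (X H : Type*) [Group X] [Group H] :
    Monoid.CoprodI (fun _ : X →* H => X) →* H :=
  Monoid.CoprodI.lift fun h => h

/-- Every group `H` receives an `X`-equivalence from an `X`-cellular group. -/
theorem exists_cellularization (X H : Type u) [Group X] [Group H] :
    ∃ (C : GrpCat.{u}) (ε : C →* H), IsHomEquiv X ε ∧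
      ∀ (Y Z : Type u) [Group Y] [Group Z] (f : Y →* Z), IsHomEquiv X f → IsHomEquiv C f := by
  set e := evalCoprod X H with he
  have hev : ∀ (h : X →* H) (x : X), e (Monoid.CoprodI.of (i := h) x) = h x := fun h x => by
    simp [he, evalCoprod]
  let N := separatingKernel X e
  let ε : Monoid.CoprodI (fun _ : X →* H => X) ⧸ N →* H :=
    QuotientGroup.lift N e (separatingKernel_le_ker X e)
  have hε : ∀ p : Monoid.CoprodI (fun _ : X →* H => X), ε p = e p := fun p => rfl
  refine ⟨GrpCat.of (Monoid.CoprodI (fun _ : X →* H => X) ⧸ N), ε, ⟨?_, ?_⟩, ?_⟩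
  · intro a b hab
    refine homSeparating_separatingKernel X e a b fun x p q hp hq => ?_
    rw [← hε, ← hε]
    have := DFunLike.congr_fun hab x
    simp only [MonoidHom.comp_apply] at this
    exact (congrArg ε hp).symm.trans (this.trans (congrArg ε hq))
  · intro h
    refine ⟨(QuotientGroup.mk' N).comp (Monoid.CoprodI.of (M := fun _ : X →* H => X) (i := h)), ?_⟩
    ext x
    exact hev h x
  · intro Y Z _ _ f hf
    refine ⟨?_, ?_⟩
    · intro a b hab
      have hab' : ∀ z, f (a z) = f (b z) := fun z => DFunLike.congr_fun hab z
      refine QuotientGroup.monoidHom_ext N (Monoid.CoprodI.ext_hom _ _ fun h => hf.1 ?_)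
      ext x
      exact hab' _
    · intro g
      -- Lift g on each free factor separately; the resulting map on the free product kills N.
      choose k hk using fun h : X →* H =>
        hf.2 ((g.comp (QuotientGroup.mk' N)).comp
          (Monoid.CoprodI.of (M := fun _ : X →* H => X) (i := h)))
      have hl : f.comp (Monoid.CoprodI.lift k) = g.comp (QuotientGroup.mk' N) := by
        refine Monoid.CoprodI.ext_hom _ _ fun h => ?_
        rw [← hk h]
        ext x
        simp
      refine ⟨QuotientGroup.lift N (Monoid.CoprodI.lift k)
        (separatingKernel_le_ker_of_isHomEquiv X e hf g _ fun p => DFunLike.congr_fun hl p), ?_⟩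
      refine QuotientGroup.monoidHom_ext N ?_
      exact hl

/-! ### Cellular covers and idempotent functors. -/

section Category

variable {X : GrpCat.{u}}

theorem isHomEquiv_hom_iff {Y Z : GrpCat.{u}} (f : Y ⟶ Z) :
    IsHomEquiv X f.hom ↔ Function.Bijective fun h : X ⟶ Y => h ≫ f := by
  have : (fun h : X ⟶ Y => h ≫ f) = (ConcreteCategory.homEquiv (X := X) (Y := Z)).symm ∘
      (fun h : X →* Y => f.hom.comp h) ∘ (ConcreteCategory.homEquiv (X := X) (Y := Y)) := rfl
  rw [this, Equiv.comp_bijective, Equiv.bijective_comp]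
  rfl

theorem exists_cellularization_hom (X H : GrpCat.{u}) :
    ∃ (C : GrpCat.{u}) (ε : C ⟶ H), (Function.Bijective fun h : X ⟶ C => h ≫ ε) ∧
      ∀ {Y Z : GrpCat.{u}} (f : Y ⟶ Z), (Function.Bijective fun h : X ⟶ Y => h ≫ f) →
        Function.Bijective fun h : C ⟶ Y => h ≫ f := by
  obtain ⟨C, ε, h1, h2⟩ := exists_cellularization X H
  refine ⟨C, GrpCat.ofHom ε, (isHomEquiv_hom_iff _).1 h1, fun {Y Z} f hf => ?_⟩
  exact (isHomEquiv_hom_iff _).1 (h2 Y Z f.hom ((isHomEquiv_hom_iff _).2 hf))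

/-- An equivalence with respect to both its source and its target is an isomorphism. -/
theorem isIso_of_bijective_comp {Y Z : GrpCat.{u}} (f : Y ⟶ Z)
    (hY : Function.Bijective fun h : Y ⟶ Y => h ≫ f)
    (hZ : Function.Bijective fun h : Z ⟶ Y => h ≫ f) : IsIso f := by
  obtain ⟨g, hg⟩ := hZ.2 (𝟙 Z)
  refine ⟨g, hY.1 ?_, hg⟩
  simp only [Category.assoc, Category.id_comp] at hg ⊢
  rw [hg, Category.comp_id]

/-- Every cellular cover is, up to isomorphism of its source, the augmentation of an idempotent
functor. -/
theorem IsCellularCover.exists_idempotentFunctor {G : GrpCat.{u}} {c : X ⟶ G}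
    (hc : IsCellularCover c) :
    ∃ φ : IdempotentFunctor.{u}, Nonempty (φ.functor.obj G ≅ X) := by
  choose C ε hε hC using exists_cellularization_hom X
  have lift_ex : ∀ {H K : GrpCat.{u}} (g : H ⟶ K), ∃ k : C H ⟶ C K, k ≫ ε K = ε H ≫ g :=
    fun {H K} g => (hC H (ε K) (hε K)).2 (ε H ≫ g)
  choose m hm using @lift_ex
  have uniq : ∀ {H K : GrpCat.{u}} {a b : C H ⟶ C K}, a ≫ ε K = b ≫ ε K → a = b :=
    fun {H K a b} h => (hC H (ε K) (hε K)).1 h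
  let F : GrpCat.{u} ⥤ GrpCat.{u} :=
    { obj := C
      map := fun g => m g
      map_id := fun H => uniq (by simp [hm])
      map_comp := fun f g => uniq (by rw [hm, Category.assoc, hm, reassoc_of% (hm f)]) }
  let φ : IdempotentFunctor.{u} :=
    { functor := F
      aug := { app := ε, naturality := fun _ _ g => hm g }
      isIso_aug_obj := fun G => isIso_of_bijective_comp (ε (C G))
        (hC _ _ (hε _)) (hC _ _ (hε _))
      isIso_map_aug := fun G => by
        -- Two out of three: by naturality `m (ε G) ≫ ε G` equals `ε (C G) ≫ ε G`, a composite of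
        -- X-equivalences.
        have h1 : Function.Bijective fun h : X ⟶ C (C G) => h ≫ m (ε G) := by
          have h2 : Function.Bijective fun h : X ⟶ C (C G) => (h ≫ m (ε G)) ≫ ε G := by
            have := (hε G).comp (hε (C G))
            convert this using 2 with h
            simp [hm]
          exact (Function.Bijective.of_comp_iff' (hε G)
            (fun h : X ⟶ C (C G) => h ≫ m (ε G))).1 h2
        exact isIso_of_bijective_comp (m (ε G)) (hC _ _ h1) (hC _ _ h1) }
  refine ⟨φ, ?_⟩
  -- Both c and `ε G` are X-equivalences from X-cellular groups, so each lifts through the other.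
  obtain ⟨s, hs⟩ := (hε G).2 c
  obtain ⟨t, ht⟩ := (hC G c hc).2 (ε G)
  refine ⟨⟨t, s, uniq ?_, hc.1 ?_⟩⟩
  · rw [Category.assoc]
    exact (congrArg (t ≫ ·) hs).trans (ht.trans (Category.id_comp _).symm)
  · simp only [Category.assoc, Category.id_comp] at hs ht ⊢
    rw [ht, hs]

/-- The augmentation of an idempotent functor is a cellular cover. -/
theorem IdempotentFunctor.isCellularCover_aug (φ : IdempotentFunctor.{u}) (G : GrpCat.{u}) :
    IsCellularCover (φ.aug.app G) := by
  have := φ.isIso_aug_obj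
  have := φ.isIso_map_aug
  refine ⟨fun a b hab => ?_, fun h => ?_⟩
  · have h1 : φ.functor.map a = φ.functor.map b := by
      rw [← cancel_mono (φ.functor.map (φ.aug.app G)), ← Functor.map_comp, ← Functor.map_comp]
      exact congrArg _ hab
    have h2 := φ.aug.naturality a
    have h3 := φ.aug.naturality b
    rw [h1, h3] at h2
    exact ((cancel_epi (φ.aug.app (φ.functor.obj G))).1 h2).symm
  · refine ⟨inv (φ.aug.app (φ.functor.obj G)) ≫ φ.functor.map h, ?_⟩
    have := φ.aug.naturality h
    simp only [Functor.id_map, Functor.id_obj] at this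
    simp [this]

end Category

/-! ### Maps from abelian groups of finite exponent to a group of prime order. -/

section PrimeQuotient

theorem exists_monoidHom_zmod_apply_ne_one {V : Type*} [CommGroup V] {p : ℕ} [Fact p.Prime]
    (hV : ∀ v : V, v ^ p = 1) {v : V} (hv : v ≠ 1) :
    ∃ φ : V →* Multiplicative (ZMod p), φ v ≠ 1 := by
  let _ : Module (ZMod p) (Additive V) := AddCommGroup.zmodModule (n := p) fun x => hV x.toMul
  by_contra! H
  refine hv (Additive.ofMul.injective
    ((Module.forall_dual_apply_eq_zero_iff (ZMod p) (Additive.ofMul v)).1 fun f => ?_))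
  exact H (AddMonoidHom.toMultiplicativeRight f.toAddMonoidHom)

/-- An abelian group of finite exponent with an element of order `p` maps nontrivially to the
group of order `p`. -/
theorem exists_monoidHom_zmod_ne_one {W : Type*} [CommGroup W] {p n : ℕ} [hp : Fact p.Prime]
    (hn : n ≠ 0) (hW : ∀ w : W, w ^ n = 1) {w : W} (hw : orderOf w = p) :
    ∃ (φ : W →* Multiplicative (ZMod p)) (v : W), φ v ≠ 1 := by
  by_contra! H
  -- Without nontrivial maps W is p-divisible. Write n = p ^ a * m with p ∤ m and w = z ^ p ^ a;
  -- then w ^ m = 1, against w having order p.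
  have root : ∀ w : W, ∃ z, z ^ p = w := by
    intro w
    by_contra hw
    have hv : (QuotientGroup.mk w : W ⧸ (powMonoidHom p : W →* W).range) ≠ 1 := by
      rw [Ne, QuotientGroup.eq_one_iff]
      exact hw
    obtain ⟨φ, hφ⟩ := exists_monoidHom_zmod_apply_ne_one (p := p) (fun v => by
      obtain ⟨z, rfl⟩ := QuotientGroup.mk_surjective v
      rw [← QuotientGroup.mk_pow, QuotientGroup.eq_one_iff]
      exact ⟨z, rfl⟩) hv
    exact hφ (H (φ.comp (QuotientGroup.mk' _)) w)
  have roots : ∀ (a : ℕ) (w : W), ∃ z, z ^ p ^ a = w := by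
    intro a
    induction a with
    | zero => exact fun w => ⟨w, by simp⟩
    | succ a ih =>
      intro w
      obtain ⟨y, rfl⟩ := root w
      obtain ⟨z, rfl⟩ := ih y
      exact ⟨z, by rw [pow_succ, pow_mul]⟩
  obtain ⟨a, m, hm, rfl⟩ := Nat.exists_eq_pow_mul_and_not_dvd hn p hp.out.ne_one
  obtain ⟨z, rfl⟩ := roots a w
  refine hm (hw ▸ orderOf_dvd_of_pow_eq_one ?_)
  rw [← pow_mul, hW]

end PrimeQuotient

/-! ### Cellular covers of finite groups are finite. -/

section Cover

open scoped commutatorElement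

variable {A G : Type*} [Group A] [Group G] {c : A →* G}

theorem IsHomEquiv.hom_ext (hc : IsHomEquiv A c) {a b : A →* A} (h : ∀ x, c (a x) = c (b x)) :
    a = b :=
  hc.1 (MonoidHom.ext h)

/-- Conjugation by a kernel element and the identity agree after composition with c. -/
theorem IsHomEquiv.ker_le_center (hc : IsHomEquiv A c) : c.ker ≤ Subgroup.center A := by
  intro k hk
  rw [MonoidHom.mem_ker] at hk
  have h : (MulAut.conj k).toMonoidHom = MonoidHom.id A := hc.hom_ext fun x => by simp [hk]
  rw [Subgroup.mem_center_iff]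
  intro x
  have := DFunLike.congr_fun h x
  simp only [MulEquiv.coe_toMonoidHom, MulAut.conj_apply, MonoidHom.id_apply] at this
  exact (mul_inv_eq_iff_eq_mul.1 this).symm

theorem IsHomEquiv.eq_one (hc : IsHomEquiv A c) {g : A →* A} (hg : ∀ x, c (g x) = 1) : g = 1 :=
  hc.hom_ext fun x => by simp [hg]

open scoped IsMulCommutative in
-- The centre has finite index, so the transfer x ↦ x ^ [A : Z(A)] is a homomorphism into it.
-- Following it by the |G|-th power gives an endomorphism that c kills, hence a trivial one.
theorem IsHomEquiv.exists_pow_eq_one [Finite G] (hc : IsHomEquiv A c) :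
    ∃ n ≠ 0, ∀ x : A, x ^ n = 1 := by
  have : (Subgroup.center A).FiniteIndex := Subgroup.finiteIndex_of_le hc.ker_le_center
  let g : A →* A := (Subgroup.center A).subtype.comp
    ((powMonoidHom (Nat.card G)).comp (MonoidHom.transferCenterPow A))
  have hg : ∀ x, g x = (x ^ (Subgroup.center A).index) ^ Nat.card G := fun x => by
    simp [g, MonoidHom.transferCenterPow_apply]
  refine ⟨(Subgroup.center A).index * Nat.card G,
    mul_ne_zero Subgroup.FiniteIndex.index_ne_zero Nat.card_pos.ne', fun x => ?_⟩
  have h1 : g = 1 := hc.eq_one fun x => by rw [hg, map_pow, pow_card_eq_one']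
  rw [pow_mul, ← hg, h1, MonoidHom.one_apply]

/-- A kernel element outside [A, A] gives p-torsion in both A^ab and ker c. Then A maps onto a group
of order p, which embeds in ker c: a nontrivial endomorphism killed by c. -/
theorem IsHomEquiv.ker_le_commutator [Finite G] (hc : IsHomEquiv A c) :
    c.ker ≤ commutator A := by
  intro k hk
  by_contra hk'
  obtain ⟨n, hn, hA⟩ := hc.exists_pow_eq_one
  have hW : ∀ w : Abelianization A, w ^ n = 1 := fun w => by
    obtain ⟨x, rfl⟩ := QuotientGroup.mk_surjective w
    exact (map_pow Abelianization.of x n).symm.trans (by rw [hA, map_one])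
  have hw : Abelianization.of k ≠ 1 := by
    rwa [Ne, ← MonoidHom.mem_ker, Abelianization.ker_of]
  obtain ⟨p, hp, hpw⟩ := Nat.exists_prime_and_dvd (mt orderOf_eq_one_iff.1 hw)
  have : Fact p.Prime := ⟨hp⟩
  have hpk : p ∣ orderOf k := hpw.trans (orderOf_map_dvd _ k)
  have hk0 : orderOf k ≠ 0 := (isOfFinOrder_iff_pow_eq_one.2
    ⟨n, Nat.pos_of_ne_zero hn, hA k⟩).orderOf_pos.ne'
  have hw0 : orderOf (Abelianization.of k) ≠ 0 := (isOfFinOrder_iff_pow_eq_one.2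
    ⟨n, Nat.pos_of_ne_zero hn, hW _⟩).orderOf_pos.ne'
  obtain ⟨φ, v, hv⟩ := exists_monoidHom_zmod_ne_one hn hW (orderOf_pow_orderOf_div hw0 hpw)
  have hcard : Nat.card (Multiplicative (ZMod p)) = p := by
    simp
  have hord : orderOf (φ v) = p := by
    rw [orderOf_eq_prime_iff]
    exact ⟨orderOf_dvd_iff_pow_eq_one.1 ((orderOf_dvd_natCard (φ v)).trans hcard.dvd), hv⟩
  let ψ := monoidHomOfForallMemZpowers (g := φ v)
    (fun x => mem_zpowers_of_prime_card hcard hv)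
    (g' := k ^ (orderOf k / p)) (by rw [hord, orderOf_pow_orderOf_div hk0 hpk])
  have hψ : ψ (φ v) = k ^ (orderOf k / p) := monoidHomOfForallMemZpowers_apply_gen _ _
  have hcψ : ∀ t, c (ψ t) = 1 := fun t => by
    obtain ⟨i, rfl⟩ := Subgroup.mem_zpowers_iff.1
      (mem_zpowers_of_prime_card hcard hv : t ∈ Subgroup.zpowers (φ v))
    rw [map_zpow, hψ, map_zpow, map_pow, MonoidHom.mem_ker.1 hk, one_pow, one_zpow]
  have h1 : ψ.comp (φ.comp Abelianization.of) = 1 := hc.eq_one fun x => hcψ _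
  obtain ⟨y, rfl⟩ := QuotientGroup.mk_surjective v
  have h2 : k ^ (orderOf k / p) = 1 := hψ.symm.trans (DFunLike.congr_fun h1 y)
  have h3 := orderOf_pow_orderOf_div hk0 hpk
  rw [h2, orderOf_one] at h3
  exact hp.ne_one h3.symm

/-- An upper bound for the order of the commutator subgroup of a central extension of a group of
order `n`. -/
def schurBound (n : ℕ) : ℕ :=
  1 + ∑ i ∈ Finset.range (n * n + 1), Subgroup.cardCommutatorBound i

theorem commutatorElement_congr_of_ker_le_center {f : A →* G} (hf : f.ker ≤ Subgroup.center A)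
    {x x' y y' : A} (hx : f x = f x') (hy : f y = f y') : ⁅x, y⁆ = ⁅x', y'⁆ := by
  have key : ∀ x y : A, f x = f y → ∃ z ∈ Subgroup.center A, x = y * z := fun x y h =>
    ⟨y⁻¹ * x, hf (by rw [MonoidHom.mem_ker, map_mul, map_inv, h, inv_mul_cancel]), by group⟩
  obtain ⟨z, hz, rfl⟩ := key _ _ hx
  obtain ⟨w, hw, rfl⟩ := key _ _ hy
  rw [Subgroup.mem_center_iff] at hz hw
  rw [commutatorElement_def, commutatorElement_def, mul_inv_rev, mul_inv_rev]
  calc x' * z * (y' * w) * (z⁻¹ * x'⁻¹) * (w⁻¹ * y'⁻¹)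
      = x' * (z * (y' * w) * z⁻¹) * x'⁻¹ * (w⁻¹ * y'⁻¹) := by group
    _ = x' * (y' * w) * x'⁻¹ * (w⁻¹ * y'⁻¹) := by rw [← hz]; group
    _ = x' * y' * (w * x'⁻¹ * w⁻¹) * y'⁻¹ := by group
    _ = x' * y' * x'⁻¹ * y'⁻¹ := by rw [← hw]; group

/-- A commutator depends only on the images of its entries in G, so there are at most |G|² of them;
Schur's theorem applies. -/
theorem finite_commutator_of_ker_le_center [Finite G] (f : A →* G)
    (hf : f.ker ≤ Subgroup.center A) :
    Finite (commutator A) ∧ Nat.card (commutator A) ≤ schurBound (Nat.card G) := by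
  choose a b hab using fun t : commutatorSet A => t.2
  let i : commutatorSet A → G × G := fun t => (f (a t), f (b t))
  have hi : Function.Injective i := fun s t hst => Subtype.ext <| by
    rw [← hab s, ← hab t]
    exact commutatorElement_congr_of_ker_le_center hf (congrArg Prod.fst hst)
      (congrArg Prod.snd hst)
  have : Finite (commutatorSet A) := Finite.of_injective i hi
  refine ⟨inferInstance, (Subgroup.card_commutator_le_of_finite_commutatorSet A).trans ?_⟩
  have hle : Nat.card (commutatorSet A) ≤ Nat.card G * Nat.card G := by
    rw [← Nat.card_prod]
    exact Nat.card_le_card_of_injective i hi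
  -- Summing over all indices up to |G|² avoids any monotonicity of `cardCommutatorBound`.
  exact (Finset.single_le_sum (f := Subgroup.cardCommutatorBound) (fun _ _ => Nat.zero_le _)
    (Finset.mem_range.2 (Nat.lt_succ_of_le hle))).trans (Nat.le_add_left _ _)

theorem IsHomEquiv.finite [Finite G] (hc : IsHomEquiv A c) : Finite A := by
  have := (finite_commutator_of_ker_le_center c hc.ker_le_center).1
  have : Finite c.ker := Finite.of_injective _ (Subgroup.inclusion_injective hc.ker_le_commutator)
  refine Nat.finite_of_card_ne_zero ?_
  rw [← c.ker.card_mul_index]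
  exact mul_ne_zero Nat.card_pos.ne' Subgroup.FiniteIndex.index_ne_zero

theorem commutator_eq_bot_of_comm (h : ∀ x y : A, x * y = y * x) : commutator A = ⊥ := by
  rw [commutator_eq_closure, Subgroup.closure_eq_bot_iff]
  rintro _ ⟨x, y, rfl⟩
  rw [Set.mem_singleton_iff, commutatorElement_eq_one_iff_mul_comm]
  exact h x y

theorem IsHomEquiv.injective_of_comm [Finite G] (hc : IsHomEquiv A c)
    (h : ∀ x y : A, x * y = y * x) : Function.Injective c := by
  rw [← MonoidHom.ker_eq_bot_iff, eq_bot_iff, ← commutator_eq_bot_of_comm h]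
  exact hc.ker_le_commutator

theorem isHomEquiv_of_bijective (hc : Function.Bijective c) : IsHomEquiv A c := by
  refine ⟨fun a b hab => ?_, fun h => ?_⟩
  · ext x
    exact hc.1 (DFunLike.congr_fun hab x)
  · refine ⟨(MulEquiv.ofBijective c hc).symm.toMonoidHom.comp h, ?_⟩
    ext x
    exact (MulEquiv.ofBijective c hc).apply_symm_apply (h x)

end Cover

/-! ### Crossed modules. -/

section Crossed

variable {A X G : Type*} [Group A] [Group X] [Group G]

/-- `f : X → G` is the boundary map of a crossed module. -/
def IsCrossed (f : X →* G) : Prop :=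
  ∃ ρ : G →* Monoid.End X, (∀ g x, f (ρ g x) = g * f x * g⁻¹) ∧
    ∀ x y, ρ (f x) y = x * y * x⁻¹

theorem isCrossed_id : IsCrossed (MonoidHom.id G) :=
  ⟨{ toFun := fun g => (MulAut.conj g).toMonoidHom
     map_one' := MonoidHom.ext fun x => by
      change (1 : G) * x * 1⁻¹ = x
      simp
     map_mul' := fun g h => MonoidHom.ext fun x => by
      change g * h * x * (g * h)⁻¹ = g * (h * x * h⁻¹) * g⁻¹
      group }, fun _ _ => rfl, fun _ _ => rfl⟩

theorem IsCrossed.ker_le_center {f : X →* G} (hf : IsCrossed f) :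
    f.ker ≤ Subgroup.center X := by
  obtain ⟨ρ, -, h⟩ := hf
  intro k hk
  rw [Subgroup.mem_center_iff]
  intro y
  have := h k y
  rw [MonoidHom.mem_ker.1 hk, map_one] at this
  exact eq_mul_inv_iff_mul_eq.1 this

theorem IsCrossed.range_normal {f : X →* G} (hf : IsCrossed f) : f.range.Normal := by
  obtain ⟨ρ, h, -⟩ := hf
  refine ⟨?_⟩
  rintro _ ⟨x, rfl⟩ g
  exact ⟨ρ g x, h g x⟩

/-- Each `ρ g` composed with c lifts uniquely to an endomorphism of A; uniqueness of lifts yields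
the action laws and the Peiffer identity. -/
theorem IsCrossed.comp {f : X →* G} (hf : IsCrossed f) {c : A →* X} (hc : IsHomEquiv A c) :
    IsCrossed (f.comp c) := by
  obtain ⟨ρ, h1, h2⟩ := hf
  choose α hα using fun g => hc.2 ((ρ g : X →* X).comp c)
  have hα' : ∀ g a, c (α g a) = ρ g (c a) := fun g a => DFunLike.congr_fun (hα g) a
  refine ⟨⟨⟨α, hc.hom_ext fun x => ?_⟩, fun g h => hc.hom_ext fun x => ?_⟩, fun g x => ?_,
    fun x y => ?_⟩
  · rw [hα', map_one]; rfl
  · rw [hα', map_mul]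
    exact (congrArg (ρ g) (hα' h x)).symm.trans (hα' g _).symm
  · exact (congrArg f (hα' g x)).trans (h1 g (c x))
  · have : α (f (c x)) = (MulAut.conj x).toMonoidHom := hc.hom_ext fun y => by
      rw [hα', h2]; simp
    exact DFunLike.congr_fun this y

end Crossed

/-! ### The non-increasing quantity. -/

section Bound

open scoped commutatorElement

variable {A X G : Type*} [Group A] [Group X] [Group G]

theorem commutator_le_map_commutator {f : X →* G} (hf : f.ker ≤ Subgroup.center X) {c : A →* X}
    (h : ∀ x, ∃ a, f (c a) = f x) : commutator X ≤ (commutator A).map c := by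
  rw [commutator_eq_closure, Subgroup.closure_le]
  rintro _ ⟨x, y, rfl⟩
  obtain ⟨a, ha⟩ := h x
  obtain ⟨b, hb⟩ := h y
  refine ⟨⁅a, b⁆, ?_, ?_⟩
  · rw [commutator_eq_closure]
    exact Subgroup.subset_closure ⟨a, b, rfl⟩
  · rw [map_commutatorElement]
    exact commutatorElement_congr_of_ker_le_center hf ha hb

theorem mem_commutator_of_map_mem {c : A →* X} (hc : c.ker ≤ commutator A) {a : A}
    (ha : c a ∈ (commutator A).map c) : a ∈ commutator A := by
  obtain ⟨b, hb, hab⟩ := ha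
  have h := mul_mem hb (hc (x := b⁻¹ * a)
    (by rw [MonoidHom.mem_ker, map_mul, map_inv, hab, inv_mul_cancel]))
  rwa [mul_inv_cancel_left] at h

theorem card_abelianization_mul_card_commutator :
    Nat.card (Abelianization X) * Nat.card (commutator X) = Nat.card X := by
  rw [mul_comm]
  exact (commutator X).card_mul_index

theorem schurBound_pos (n : ℕ) : 0 < schurBound n :=
  Nat.add_pos_left one_pos _

/-- The quantity that does not increase when a crossed module is composed with a cellular cover. -/
theorem card_abelianization_mul_pow_le [Finite G] [Finite X] {f : X →* G} (hf : IsCrossed f)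
    {c : A →* X} (hc : IsHomEquiv A c) :
    Nat.card (Abelianization A) * schurBound (Nat.card G) ^ Nat.card (f.comp c).range ≤
      Nat.card (Abelianization X) * schurBound (Nat.card G) ^ Nat.card f.range := by
  have hA : Finite A := hc.finite
  have hle : (f.comp c).range ≤ f.range := by
    rintro _ ⟨a, rfl⟩
    exact ⟨c a, rfl⟩
  rcases hle.eq_or_lt with h | h
  -- Same image: [X, X] ≤ c([A, A]) and ker c ≤ [A, A], so A^ab → X^ab is injective.
  · rw [h]
    refine Nat.mul_le_mul_right _ ?_
    have hex : ∀ x, ∃ a, f (c a) = f x := fun x => by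
      have : f x ∈ (f.comp c).range := h ▸ ⟨x, rfl⟩
      exact this
    refine Nat.card_le_card_of_injective (Abelianization.map c) ?_
    rw [injective_iff_map_eq_one]
    intro w hw
    obtain ⟨a, rfl⟩ := QuotientGroup.mk_surjective w
    have h1 : c a ∈ commutator X := by
      rw [← Abelianization.ker_of, MonoidHom.mem_ker]
      exact hw
    have h2 := mem_commutator_of_map_mem hc.ker_le_commutator
      (commutator_le_map_commutator hf.ker_le_center hex h1)
    rw [← Abelianization.ker_of, MonoidHom.mem_ker] at h2
    exact h2
  -- Smaller image: |A^ab| ≤ |c(A)| ≤ |X| ≤ |X^ab| · B, and the exponent of B has dropped by at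
  -- least one.
  · have hlt : Nat.card (f.comp c).range + 1 ≤ Nat.card f.range :=
      Set.ncard_lt_ncard h
    have h1 : Nat.card (Abelianization A) ≤ Nat.card X :=
      calc Nat.card (Abelianization A) = (commutator A).index := rfl
        _ ≤ c.ker.index := Nat.le_of_dvd (Nat.pos_of_ne_zero Subgroup.FiniteIndex.index_ne_zero)
            (Subgroup.index_dvd_of_le hc.ker_le_commutator)
        _ = Nat.card c.range := Subgroup.index_ker c
        _ ≤ Nat.card X := Subgroup.card_le_card_group _
    have h2 : Nat.card X ≤ Nat.card (Abelianization X) * schurBound (Nat.card G) := by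
      rw [← card_abelianization_mul_card_commutator]
      exact Nat.mul_le_mul_left _ (finite_commutator_of_ker_le_center f hf.ker_le_center).2
    calc _ ≤ Nat.card (Abelianization X) * schurBound (Nat.card G) *
          schurBound (Nat.card G) ^ Nat.card (f.comp c).range := Nat.mul_le_mul_right _ (h1.trans h2)
      _ = Nat.card (Abelianization X) *
          schurBound (Nat.card G) ^ (Nat.card (f.comp c).range + 1) := by ring
      _ ≤ _ := Nat.mul_le_mul_left _ (Nat.pow_le_pow_right (schurBound_pos _) hlt)

end Bound

/-! ### Finiteness of `IdemInfty`. -/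

theorem exists_group_groupClass_eq (X : GrpCat.{u}) {α : Type} (e : α ≃ X) :
    ∃ _ : Group α, groupClass (GrpCat.of (ULift.{u} α)) = groupClass X :=
  let _ : Group α := e.group
  ⟨inferInstance, Quotient.sound ⟨MulEquiv.toGrpIso (MulEquiv.ulift.trans e.mulEquiv)⟩⟩

theorem finite_setOf_groupClass_card_le (N : ℕ) :
    {x : GroupClass.{u} | ∃ X : GrpCat.{u}, Finite X ∧ Nat.card X ≤ N ∧
      x = groupClass X}.Finite := by
  have hfin : ∀ n : ℕ, Finite (Group (Fin n)) := fun n =>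
    Finite.of_injective (fun g : Group (Fin n) => (g.mul : Fin n → Fin n → Fin n))
      fun g h hgh => Group.ext hgh
  refine (Set.finite_range fun s : Σ n : Fin (N + 1), Group (Fin n) =>
    have := s.2
    groupClass (GrpCat.of (ULift.{u} (Fin s.1)))).subset ?_
  rintro _ ⟨X, hX, hcard, rfl⟩
  obtain ⟨g, hg⟩ := exists_group_groupClass_eq X (Finite.equivFin X).symm
  exact ⟨⟨⟨Nat.card X, Nat.lt_succ_of_le hcard⟩, g⟩, hg⟩

/-- Induction along the augmentations of a composite of idempotent functors. -/
theorem compositeFunctor_induction {G : GrpCat.{u}} (P : ∀ X : GrpCat.{u}, (X →* G) → Prop)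
    (base : P G (MonoidHom.id G))
    (step : ∀ (X Y : GrpCat.{u}) (f : X →* G) (c : Y →* X), P X f → IsHomEquiv Y c →
      P Y (f.comp c)) (l : List IdempotentFunctor.{u}) :
    ∃ f : (compositeFunctor l).obj G →* G, P ((compositeFunctor l).obj G) f := by
  induction l with
  | nil => exact ⟨_, base⟩
  | cons φ l ih =>
    obtain ⟨f, hf⟩ := ih
    exact ⟨_, step _ _ f (φ.aug.app ((compositeFunctor l).obj G)).hom hf
      ((isHomEquiv_hom_iff _).2 (φ.isCellularCover_aug _))⟩

theorem finite_idemInfty (G : Type u) [Group G] [Finite G] :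
    (IdemInfty (GrpCat.of G)).Finite := by
  set B := schurBound (Nat.card G) with hB
  refine (finite_setOf_groupClass_card_le (Nat.card G * B ^ Nat.card G * B)).subset ?_
  intro x hx
  simp only [IdemInfty, Set.mem_iUnion] at hx
  obtain ⟨n, -, l, -, rfl⟩ := hx
  obtain ⟨f, hf, hfin, hle⟩ := compositeFunctor_induction (G := GrpCat.of G)
    (fun X f => IsCrossed f ∧ Finite X ∧
      Nat.card (Abelianization X) * B ^ Nat.card f.range ≤ Nat.card G * B ^ Nat.card G)
    ⟨isCrossed_id, ‹Finite G›, Nat.mul_le_mul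
      (Nat.card_le_card_of_surjective (Abelianization.of (G := G)) QuotientGroup.mk_surjective)
      (Nat.pow_le_pow_right (schurBound_pos _) (Subgroup.card_le_card_group _))⟩
    (fun X Y f c ⟨hf, hX, hle⟩ hc => by
      have : Finite (GrpCat.of G) := ‹Finite G›
      exact ⟨hf.comp hc, hc.finite, (card_abelianization_mul_pow_le hf hc).trans hle⟩) l
  have : Finite (GrpCat.of G) := ‹Finite G›
  refine ⟨_, hfin, ?_, rfl⟩
  rw [← card_abelianization_mul_card_commutator]
  refine Nat.mul_le_mul ?_ (finite_commutator_of_ker_le_center f hf.ker_le_center).2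
  exact (Nat.le_mul_of_pos_right _ (Nat.pow_pos (schurBound_pos _))).trans hle

/-! ### Composing covers over a simple group. -/

section Simple

open scoped commutatorElement

variable {A B X Y G : Type*} [Group A] [Group B] [Group X] [Group Y] [Group G]

/-- A finite abelian group surjects onto a cyclic group of order its exponent. -/
theorem exists_monoidHom_apply_eq_of_orderOf_dvd_exponent [Finite B]
    (hB : ∀ x y : B, x * y = y * x) {y : Y} (hy : orderOf y ∣ Monoid.exponent B) :
    ∃ (t : B →* Y) (b : B), t b = y := by
  let _ : CommGroup B := { mul_comm := hB }
  have : NeZero (Monoid.exponent B) := ⟨Monoid.exponent_ne_zero_of_finite⟩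
  -- B is isomorphic to its group of complex characters, so some character has order the exponent of
  -- B; its image is the required cyclic quotient.
  let e := (CommGroup.monoidHom_mulEquiv_of_hasEnoughRootsOfUnity B ℂ).some
  obtain ⟨b, hb⟩ := Monoid.exists_orderOf_eq_exponent (Monoid.ExponentExists.of_finite (G := B))
  have : Finite (e.symm b).range := Finite.of_surjective _ (e.symm b).rangeRestrict_surjective
  obtain ⟨g, hg⟩ := IsCyclic.exists_generator (α := (e.symm b).range)
  obtain ⟨b₀, hb₀⟩ := (e.symm b).rangeRestrict_surjective g
  have hord : Monoid.exponent B ∣ orderOf g := by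
    rw [← hb, ← MulEquiv.orderOf_eq e.symm b]
    refine orderOf_dvd_of_pow_eq_one (MonoidHom.ext fun x => ?_)
    have h1 : (e.symm b).rangeRestrict x ^ orderOf g = 1 :=
      orderOf_dvd_iff_pow_eq_one.1 (orderOf_dvd_of_mem_zpowers (hg _))
    exact congrArg Subtype.val h1
  refine ⟨(monoidHomOfForallMemZpowers hg (hy.trans hord)).comp (e.symm b).rangeRestrict, b₀, ?_⟩
  rw [MonoidHom.comp_apply, hb₀, monoidHomOfForallMemZpowers_apply_gen]

theorem exists_lift_of_injective {c : B →* Y} (hc : Function.Injective c) (h : A →* Y)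
    (hr : ∀ x, h x ∈ c.range) : ∃ k : A →* B, c.comp k = h := by
  refine ⟨(MonoidHom.ofInjective hc).symm.toMonoidHom.comp (h.codRestrict c.range hr), ?_⟩
  ext x
  exact congrArg Subtype.val
    ((MonoidHom.ofInjective hc).apply_symm_apply (h.codRestrict c.range hr x))

/-- Cellular covers by finite abelian groups compose. -/
theorem IsHomEquiv.comp_of_comm [Finite Y] {c₂ : B →* Y} (h₂ : IsHomEquiv B c₂)
    (hB : ∀ x y : B, x * y = y * x) {c : A →* B} (hc : IsHomEquiv A c)
    (hinj : Function.Injective c) : IsHomEquiv A (c₂.comp c) := by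
  have := h₂.finite
  have hinj₂ := h₂.injective_of_comm hB
  refine ⟨fun a b hab => hc.hom_ext fun x => hinj₂ (DFunLike.congr_fun hab x), fun h => ?_⟩
  -- Orders of values of h divide the exponent of B, so each value is also a value of some B → Y,
  -- and that map factors through c₂.
  have hr : ∀ x, h x ∈ c₂.range := fun x => by
    have hx : orderOf (h x) ∣ Monoid.exponent B := by
      refine (orderOf_map_dvd h x).trans ?_
      rw [← orderOf_injective c hinj]
      exact Monoid.order_dvd_exponent _
    obtain ⟨t, b, ht⟩ := exists_monoidHom_apply_eq_of_orderOf_dvd_exponent hB hx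
    obtain ⟨s, rfl⟩ := h₂.2 t
    exact ⟨s b, ht⟩
  obtain ⟨k, rfl⟩ := exists_lift_of_injective hinj₂ h hr
  obtain ⟨s, rfl⟩ := hc.2 k
  exact ⟨s, rfl⟩

theorem comm_of_ker_le_center_of_trivial {f : X →* G} (hf : f.ker ≤ Subgroup.center X)
    (h : ∀ x, f x = 1) (x y : X) : x * y = y * x :=
  (Subgroup.mem_center_iff.1 (hf (MonoidHom.mem_ker.2 (h x))) y).symm

/-- An abelian simple group is cyclic, and a central extension of a cyclic group is abelian. -/
theorem comm_of_isSimpleGroup_of_comm [IsSimpleGroup G] (hG : ∀ a b : G, a * b = b * a)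
    {f : X →* G} (hf : f.ker ≤ Subgroup.center X) (x y : X) : x * y = y * x := by
  let _ : CommGroup G := { mul_comm := hG }
  have : IsCyclic G := IsSimpleGroup.isCyclic
  exact (f.isMulCommutative_of_isCyclic_of_ker_le_center hf).is_comm.comm x y

theorem commutator_eq_top_of_isSimpleGroup [IsSimpleGroup G]
    (hG : ¬ ∀ a b : G, a * b = b * a) : commutator G = ⊤ := by
  refine (Subgroup.Normal.eq_bot_or_eq_top inferInstance).resolve_left fun h => hG fun a b => ?_
  rw [commutator_eq_closure, Subgroup.closure_eq_bot_iff] at h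
  exact commutatorElement_eq_one_iff_mul_comm.1 (h ⟨a, b, rfl⟩)

theorem center_eq_bot_of_isSimpleGroup [IsSimpleGroup G]
    (hG : ¬ ∀ a b : G, a * b = b * a) : Subgroup.center G = ⊥ := by
  refine (Subgroup.Normal.eq_bot_or_eq_top inferInstance).resolve_right fun h => hG fun a b => ?_
  exact Subgroup.mem_center_iff.1 (h ▸ Subgroup.mem_top b : b ∈ Subgroup.center G) a

/-- A homomorphism from a finite perfect central extension of a nonabelian finite simple group to
that simple group kills the kernel of the extension. -/
theorem ker_le_ker_of_isSimpleGroup [IsSimpleGroup G] [Finite G]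
    (hG : ¬ ∀ a b : G, a * b = b * a) {f : A →* G} (hf : f.ker ≤ Subgroup.center A)
    (hsurj : Function.Surjective f) (hA : commutator A = ⊤) (h : A →* G) : f.ker ≤ h.ker := by
  have hn : (h.ker.map f).Normal := Subgroup.Normal.map inferInstance f hsurj
  intro k hk
  have hk' := Subgroup.mem_center_iff.1 (hf hk)
  rcases hn.eq_bot_or_eq_top with hbot | htop
  -- Comparing indices, h is onto, so it sends the central element k into the trivial centre of G.
  · have hle : h.ker ≤ f.ker := (Subgroup.map_eq_bot_iff _).1 hbot
    have hidx : f.ker.index = Nat.card G := by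
      rw [Subgroup.index_ker, MonoidHom.range_eq_top.2 hsurj, Subgroup.card_top]
    have hidx' : h.ker.index = Nat.card h.range := Subgroup.index_ker h
    have hpos : 0 < Nat.card h.range := Nat.card_pos
    have hge : Nat.card G ≤ Nat.card h.range := by
      rw [← hidx, ← hidx']
      exact Nat.le_of_dvd (hidx' ▸ hpos) (Subgroup.index_dvd_of_le hle)
    have hh : Function.Surjective h :=
      MonoidHom.range_eq_top.1 (Subgroup.eq_top_of_le_card _ hge)
    have : h k ∈ Subgroup.center G := Subgroup.mem_center_iff.2 fun g => by
      obtain ⟨x, rfl⟩ := hh g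
      rw [← map_mul, ← map_mul, hk']
    rw [center_eq_bot_of_isSimpleGroup hG] at this
    exact this
  -- Here A = ker f · ker h, so h has abelian image; A is perfect, so h is trivial.
  · have key : ∀ x, ∃ z ∈ Subgroup.center A, h z = h x := fun x => by
      obtain ⟨n, hn, hnx⟩ : f x ∈ h.ker.map f := htop ▸ Subgroup.mem_top _
      refine ⟨n⁻¹ * x, hf ?_, ?_⟩
      · rw [MonoidHom.mem_ker, map_mul, map_inv, hnx, inv_mul_cancel]
      · rw [map_mul, map_inv, MonoidHom.mem_ker.1 hn, inv_one, one_mul]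
    have : commutator A ≤ h.ker := by
      rw [commutator_eq_closure, Subgroup.closure_le]
      rintro _ ⟨x, y, rfl⟩
      obtain ⟨z, hz, hzx⟩ := key x
      rw [SetLike.mem_coe, MonoidHom.mem_ker, map_commutatorElement,
        commutatorElement_eq_one_iff_mul_comm, ← hzx, ← map_mul, ← map_mul,
        Subgroup.mem_center_iff.1 hz]
    exact this (hA ▸ Subgroup.mem_top k)

theorem hom_ext_of_commutator_eq_top (hA : commutator A = ⊤) {f : X →* G}
    (hf : f.ker ≤ Subgroup.center X) {a b : A →* X} (h : ∀ x, f (a x) = f (b x)) : a = b := by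
  have hle : commutator A ≤ a.eqLocus b := by
    rw [commutator_eq_closure, Subgroup.closure_le]
    rintro _ ⟨x, y, rfl⟩
    change a ⁅x, y⁆ = b ⁅x, y⁆
    rw [map_commutatorElement, map_commutatorElement]
    exact commutatorElement_congr_of_ker_le_center hf (h x) (h y)
  ext x
  exact hle (hA ▸ Subgroup.mem_top x)

theorem commutator_le_map_of_surjective {g : A →* X} (hg : Function.Surjective g) :
    commutator X ≤ (commutator A).map g := by
  have := Subgroup.map_commutator (⊤ : Subgroup A) ⊤ g
  rw [Subgroup.map_top_of_surjective g hg] at this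
  exact this.ge

/-- Surjective cellular covers over a finite simple group compose. -/
theorem IsHomEquiv.comp_of_surjective [IsSimpleGroup G] [Finite G] {f : X →* G}
    (hf : IsHomEquiv X f) (hfs : Function.Surjective f) {c : A →* X} (hc : IsHomEquiv A c)
    (hcs : Function.Surjective c) (hker : (f.comp c).ker ≤ Subgroup.center A) :
    IsHomEquiv A (f.comp c) := by
  have := hf.finite
  have hs : Function.Surjective (f.comp c) := hfs.comp hcs
  have hcA := hc.ker_le_commutator
  have hle : (f.comp c).ker ≤ commutator A := fun k hk =>
    mem_commutator_of_map_mem hcA (commutator_le_map_of_surjective hcs (hf.ker_le_commutator hk))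
  by_cases hG : ∀ a b : G, a * b = b * a
  · refine isHomEquiv_of_bijective ⟨?_, hs⟩
    rw [← MonoidHom.ker_eq_bot_iff, eq_bot_iff,
      ← commutator_eq_bot_of_comm (comm_of_isSimpleGroup_of_comm hG hker)]
    exact hle
  · have hA : commutator A = ⊤ := eq_top_iff.2 fun x _ => mem_commutator_of_map_mem hle
      (commutator_le_map_of_surjective hs
        (commutator_eq_top_of_isSimpleGroup hG ▸ Subgroup.mem_top _))
    refine ⟨fun a b hab => hom_ext_of_commutator_eq_top hA hker
      fun x => DFunLike.congr_fun hab x, fun h => ?_⟩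
    -- h descends to an endomorphism α of G, which is then lifted through f and through c.
    let α : G →* G := (f.comp c).liftOfSurjective hs
      ⟨h, ker_le_ker_of_isSimpleGroup hG hker hs hA h⟩
    have hα : ∀ x, α (f (c x)) = h x := fun x =>
      MonoidHom.liftOfRightInverse_comp_apply _ _ _
        ⟨h, ker_le_ker_of_isSimpleGroup hG hker hs hA h⟩ x
    obtain ⟨a, ha⟩ := hf.2 (α.comp f)
    obtain ⟨b, hb⟩ := hc.2 (a.comp c)
    refine ⟨b, MonoidHom.ext fun x => ?_⟩
    rw [← hα]
    exact (congrArg f (DFunLike.congr_fun hb x)).trans (DFunLike.congr_fun ha (c x))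

end Simple

/-- The two kinds of iterated cellular covers of a simple group: surjective cellular covers, and
trivial homomorphisms from abelian groups. -/
def IsSimpleTower {X G : Type u} [Group X] [Group G] (f : X →* G) : Prop :=
  (Function.Surjective f ∧ IsHomEquiv X f) ∨
  ((∀ x, f x = 1) ∧ (∀ x y : X, x * y = y * x) ∧
    (Subsingleton X ∨ ¬ ∀ a b : G, a * b = b * a) ∧
    ∃ (Y : GrpCat.{u}) (c₁ : Y →* G) (c₂ : X →* Y),
      IsHomEquiv Y c₁ ∧ IsHomEquiv X c₂ ∧ f = c₁.comp c₂)

/-! ### Classification of iterated covers of a simple group. -/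

section Tower

variable {A X X' G : Type u} [Group A] [Group X] [Group X'] [Group G]

theorem isSimpleTower_id : IsSimpleTower (MonoidHom.id G) :=
  .inl ⟨Function.surjective_id, isHomEquiv_of_bijective Function.bijective_id⟩

theorem IsSimpleTower.comp [Finite G] [IsSimpleGroup G] [Finite X] {f : X →* G}
    (hf : IsSimpleTower f) (hfc : IsCrossed f) {c : A →* X} (hc : IsHomEquiv A c) : IsSimpleTower (f.comp c) := by
  have hcr := hfc.comp hc
  rcases hf with ⟨hs, hf⟩ | ⟨htriv, hX, hsub, Y, c₁, c₂, h₁, h₂, rfl⟩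
  · rcases hcr.range_normal.eq_bot_or_eq_top with hbot | htop
    · have htriv : ∀ x, f.comp c x = 1 := fun x =>
        Subgroup.mem_bot.1 (hbot ▸ MonoidHom.mem_range.2 ⟨x, rfl⟩)
      have hA := comm_of_ker_le_center_of_trivial hcr.ker_le_center htriv
      refine .inr ⟨htriv, hA, ?_, GrpCat.of X, f, c, hf, hc, rfl⟩
      by_cases hG : ∀ a b : G, a * b = b * a
      -- For abelian G every source is abelian, so both covers are injective and a trivial composite
      -- has trivial source.
      · have hinj : Function.Injective (f.comp c) :=
          (hf.injective_of_comm (comm_of_isSimpleGroup_of_comm hG hfc.ker_le_center)).comp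
            (hc.injective_of_comm hA)
        exact .inl ⟨fun x y => hinj ((htriv x).trans (htriv y).symm)⟩
      · exact .inr hG
    · have hs' : Function.Surjective (f.comp c) := MonoidHom.range_eq_top.1 htop
      -- c is onto: its image covers X modulo ker f, and ker f ≤ [X, X] ≤ c(A).
      have hle : commutator X ≤ c.range :=
        (commutator_le_map_commutator (c := c) hfc.ker_le_center fun x => hs' (f x)).trans
          (Subgroup.map_le_range _ _)
      have hcs : Function.Surjective c := fun x => by
        obtain ⟨a, ha⟩ := hs' (f x)
        obtain ⟨b, hb⟩ := hle (hf.ker_le_commutator (x := (c a)⁻¹ * x) (by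
          rw [MonoidHom.mem_ker, map_mul, map_inv, inv_mul_eq_one]
          exact ha))
        exact ⟨a * b, by rw [map_mul, hb, mul_inv_cancel_left]⟩
      exact .inl ⟨hs', hf.comp_of_surjective hs hc hcs hcr.ker_le_center⟩
  · have htriv' : ∀ x, (c₁.comp c₂).comp c x = 1 := fun x => htriv (c x)
    have hA := comm_of_ker_le_center_of_trivial hcr.ker_le_center htriv'
    have hinj := hc.injective_of_comm hA
    have := h₁.finite
    refine .inr ⟨htriv', hA, hsub.imp_left fun (_ : Subsingleton X) => hinj.subsingleton, Y, c₁, c₂.comp c, h₁,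
      h₂.comp_of_comm hX hc hinj, rfl⟩

/-- The clause "X trivial or G nonabelian" keeps the two kinds apart: G is nontrivial, and an
abelian source cannot map onto a nonabelian group. -/
theorem IsSimpleTower.exists_mulEquiv [IsSimpleGroup G] {f : X →* G} (hf : IsSimpleTower f)
    {f' : X' →* G} (hf' : IsSimpleTower f') (e : X ≃* X') : ∃ i : X ≃* X', f'.comp i.toMonoidHom = f := by
  have mixed : ∀ {X X' : Type u} [Group X] [Group X'] {f : X →* G} (_ : X ≃* X'),
      Function.Surjective f → (∀ x y : X', x * y = y * x) →
      (Subsingleton X' ∨ ¬ ∀ a b : G, a * b = b * a) → False := by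
    intro X X' _ _ f e hs hX' hsub
    rcases hsub with hsub | hG
    · have := e.toEquiv.subsingleton
      exact not_subsingleton G hs.subsingleton
    · refine hG fun a b => ?_
      obtain ⟨x, rfl⟩ := hs a
      obtain ⟨y, rfl⟩ := hs b
      rw [← map_mul, ← map_mul, e.injective ((map_mul e x y).trans
        ((hX' _ _).trans (map_mul e y x).symm))]
  rcases hf with ⟨hs, hf⟩ | ⟨htriv, hX, hsub, -⟩ <;>
    rcases hf' with ⟨hs', hf'⟩ | ⟨htriv', hX', hsub', -⟩
  -- f h = f' e and f' h' = f e⁻¹, so h' e and h e⁻¹ commute with the maps to G and are mutually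
  -- inverse by uniqueness of lifts.
  · obtain ⟨h, hh⟩ := hf.2 (f'.comp e.toMonoidHom)
    obtain ⟨h', hh'⟩ := hf'.2 (f.comp e.symm.toMonoidHom)
    have k : ∀ x, f (h x) = f' (e x) := fun x => DFunLike.congr_fun hh x
    have k' : ∀ x, f' (h' x) = f (e.symm x) := fun x => DFunLike.congr_fun hh' x
    refine ⟨MonoidHom.toMulEquiv (h'.comp e.toMonoidHom) (h.comp e.symm.toMonoidHom)
      (hf.hom_ext fun x => ?_) (hf'.hom_ext fun x => ?_), MonoidHom.ext fun x => ?_⟩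
    · change f (h (e.symm (h' (e x)))) = f x
      rw [k, e.apply_symm_apply, k', e.symm_apply_apply]
    · change f' (h' (e (h (e.symm x)))) = f' x
      rw [k', e.symm_apply_apply, k, e.apply_symm_apply]
    · change f' (h' (e x)) = f x
      rw [k', e.symm_apply_apply]
  · exact (mixed e hs hX' hsub').elim
  · exact (mixed e.symm hs' hX hsub).elim
  · exact ⟨e, MonoidHom.ext fun x => (htriv' _).trans (htriv x).symm⟩

end Tower

/-! ### Two-step covers and the main theorem. -/

theorem isIteratedCellularCover_two_iff {X G : GrpCat.{u}} {f : X ⟶ G} :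
    IsIteratedCellularCover 2 f ↔ ∃ (Y : GrpCat.{u}) (c₂ : X ⟶ Y) (c₁ : Y ⟶ G),
      IsCellularCover c₂ ∧ IsCellularCover c₁ ∧ f = c₂ ≫ c₁ := by
  constructor
  · intro h
    cases h with
    | comp hf hc =>
      cases hf with
      | single hd => exact ⟨_, _, _, hd, hc, rfl⟩
      | comp hf => nomatch hf
  · rintro ⟨Y, c₂, c₁, h₂, h₁, rfl⟩
    exact .comp (.single h₂) h₁

theorem IsIteratedCellularCover.groupClass_mem_idemIter {X G : GrpCat.{u}} {f : X ⟶ G}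
    (hf : IsIteratedCellularCover 2 f) : groupClass X ∈ IdemIter 2 G := by
  obtain ⟨Y, c₂, c₁, h₂, h₁, -⟩ := isIteratedCellularCover_two_iff.1 hf
  obtain ⟨φ₁, ⟨i₁⟩⟩ := h₁.exists_idempotentFunctor
  obtain ⟨φ₂, ⟨i₂⟩⟩ := h₂.exists_idempotentFunctor
  -- The last entry acts first: φ₂(φ₁(G)) ≅ φ₂(Y) ≅ X.
  exact ⟨[φ₂, φ₁], rfl, Quotient.sound ⟨(φ₂.functor.mapIso i₁ ≪≫ i₂).symm⟩⟩

theorem IsCellularCover.id (X : GrpCat.{u}) : IsCellularCover (𝟙 X) := by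
  simp only [IsCellularCover, Category.comp_id]
  exact Function.bijective_id

theorem IsSimpleTower.isIteratedCellularCover {X G : GrpCat.{u}} {f : X →* G}
    (hf : IsSimpleTower f) : IsIteratedCellularCover 2 (GrpCat.ofHom f) := by
  rw [isIteratedCellularCover_two_iff]
  rcases hf with ⟨-, hf⟩ | ⟨-, -, -, Y, c₁, c₂, h₁, h₂, rfl⟩
  · exact ⟨X, 𝟙 X, GrpCat.ofHom f, .id X, (isHomEquiv_hom_iff _).1 hf, rfl⟩
  · exact ⟨Y, GrpCat.ofHom c₂, GrpCat.ofHom c₁, (isHomEquiv_hom_iff _).1 h₂,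
      (isHomEquiv_hom_iff _).1 h₁, rfl⟩

theorem IsIteratedCellularCover.isSimpleTower {X G : GrpCat.{u}} [Finite G] [IsSimpleGroup G]
    {f : X ⟶ G} (hf : IsIteratedCellularCover 2 f) : IsSimpleTower f.hom := by
  obtain ⟨Y, c₂, c₁, h₂, h₁, rfl⟩ := isIteratedCellularCover_two_iff.1 hf
  replace h₁ := (isHomEquiv_hom_iff c₁).2 h₁
  have := h₁.finite
  exact (isSimpleTower_id.comp isCrossed_id h₁).comp (isCrossed_id.comp h₁)
    ((isHomEquiv_hom_iff c₂).2 h₂)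

theorem exists_isSimpleTower (G : Type u) [Group G] [Finite G] [IsSimpleGroup G]
    (l : List IdempotentFunctor.{u}) :
    ∃ f : (compositeFunctor l).obj (GrpCat.of G) →* GrpCat.of G, IsSimpleTower f := by
  have : Finite (GrpCat.of G) := ‹Finite G›
  have : IsSimpleGroup (GrpCat.of G) := ‹IsSimpleGroup G›
  obtain ⟨f, -, -, hf⟩ := compositeFunctor_induction (G := GrpCat.of G)
    (fun X f => IsCrossed f ∧ Finite X ∧ IsSimpleTower f)
    ⟨isCrossed_id, ‹Finite G›, isSimpleTower_id⟩
    (fun X Y f c ⟨hf, hX, ht⟩ hc => ⟨hf.comp hc, hc.finite, ht.comp hf hc⟩) l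
  exact ⟨f, hf⟩

theorem theoremD (G : Type u) [Group G] [Finite G] :
    (IdemInfty (GrpCat.of G)).Finite ∧
      (IsSimpleGroup G →
        IdemInfty (GrpCat.of G) = IdemIter 2 (GrpCat.of G) ∧
        Set.BijOn (sourceClass (GrpCat.of G))
          (CovIter 2 (GrpCat.of G)) (IdemInfty (GrpCat.of G))) := by
  refine ⟨finite_idemInfty G, fun _ => ?_⟩
  have : Finite (GrpCat.of G) := ‹Finite G›
  have : IsSimpleGroup (GrpCat.of G) := ‹IsSimpleGroup G›
  have h2 : IdemIter 2 (GrpCat.of G) ⊆ IdemInfty (GrpCat.of G) := fun x hx =>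
    Set.mem_biUnion (show (2 : ℕ) ∈ Set.Ici 1 by simp) hx
  have hex : ∀ x ∈ IdemInfty (GrpCat.of G), ∃ (X : GrpCat.{u}) (f : X ⟶ GrpCat.of G),
      IsIteratedCellularCover 2 f ∧ x = groupClass X := by
    intro x hx
    simp only [IdemInfty, Set.mem_iUnion] at hx
    obtain ⟨n, -, l, -, rfl⟩ := hx
    obtain ⟨f, hf⟩ := exists_isSimpleTower G l
    exact ⟨_, _, hf.isIteratedCellularCover, rfl⟩
  refine ⟨subset_antisymm (fun x hx => ?_) h2, ?_, ?_, ?_⟩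
  · obtain ⟨X, f, hf, rfl⟩ := hex x hx
    exact hf.groupClass_mem_idemIter
  · rintro _ ⟨X, f, hf, rfl⟩
    exact h2 hf.groupClass_mem_idemIter
  · rintro _ ⟨X, f, hf, rfl⟩ _ ⟨X', f', hf', rfl⟩ h
    obtain ⟨e⟩ : Nonempty (X ≅ X') := Quotient.exact h
    obtain ⟨i, hi⟩ := hf.isSimpleTower.exists_mulEquiv hf'.isSimpleTower e.groupIsoToMulEquiv
    refine Quotient.sound ⟨Over.isoMk (MulEquiv.toGrpIso i) ?_⟩
    ext x
    exact DFunLike.congr_fun hi x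
  · intro x hx
    obtain ⟨X, f, hf, rfl⟩ := hex x hx
    exact ⟨homClass f, ⟨X, f, hf, rfl⟩, rfl⟩
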